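/- Let $p$ be a prime and let $\mathbb{C}_p$ be the completion of an algebraic closure of $\mathbb{Q}_p$. For a subgroup $G\subset \mathrm{PGL}_2(\mathbb{C}_p)$ call $x\in\mathbb{P}^1(\mathbb{C}_p)$ a limit point of $G$ if $x=\lim \gamma_n(y)$ for some $y\in\mathbb{P}^1(\mathbb{C}_p)$ and pairwise different $\gamma_n\in G$. The group $G$ is discontinuous if some point of $\mathbb{P}^1(\mathbb{C}_p)$ is not a limit point and the closure of the orbit $Gx$ is compact for every $x\in\mathbb{P}^1(\mathbb{C}_p)$. A Schottky group is a finitely generated discontinuous group without non-trivial elements of finite order. An element of $\mathrm{PGL}_2(\mathbb{C}_p)$ is elliptic if its two eigenvalues are different and have the same absolute value. Let $G\subset\mathrm{PGL}_2(\mathbb{C}_p)$ be a finitely generated discontinuous group. Let $k\subset\mathbb{C}_p$ be an extension of $\mathbb{Q}_p$ generated by the coefficients of matrices representing finitely many generators of $G$ and by the fixed points of representatives of the conjugacy classes of elliptic elements of $G$. The vertices of the Bruhat–Tits tree $\mathcal{B}(k)$ are the balls $B(x,r)=\{y\in k: |x-y|\le r\}$ with $x\in k$ and $r\in|k^\times|$;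 two balls $B(x,r)\subset B(x',r')$ are joined by an edge if $r<r'$ and $[r,r']\cap|k^\times|=\{r,r'\}$. The group $G$ acts on the vertices by identifying $B(x,r)$ with the homothety class of the lattice generated by the vectors $(y,1)$, $y\in B(x,r)$, over the ring of integers of $\mathbb{C}_p$. Let $F(G)\subset\mathbb{P}^1(\mathbb{C}_p)$ be the set of fixed points of the non-trivial elements of $G$, and let $\mathcal{T}^*(G)$ be the subgraph of $\mathcal{B}(k)$ induced on the union of the paths joining two different points of $F(G)$. Here the path joining $a,b\in\mathbb{C}_p$ consists of the vertices $B(x,r)$ with $r\le|a-b|$ and $|a-x|\le r$ or $|b-x|\le r$, and the path joining $a\in\mathbb{C}_p$ and $\infty$ of the vertices $B(x,r)$ with $|a-x|\le r$. The vertex groups of the quotient graph of groups $\mathcal{G}^*(G)=\mathcal{T}^*(G)/G$ are the stabilizers in $G$ of the vertices of $\mathcal{T}^*(G)$; each vertex of $\mathcal{G}^*(G)$ determines one conjugacy class of such groups. Let $H$ be a finite group and $\varphi: G\to H$ a homomorphism. Then, for every choice of $k$ as above, the following are equivalent: (i) $\ker\varphi$ is a Schottky group; (ii) $\varphi|_{G_i}$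 is injective for every vertex group $G_i$ of $\mathcal{G}^*(G)$. -/

import Mathlib

open scoped MatrixGroups LinearAlgebra.Projectivization

namespace DiscontinuousGroups

noncomputable section

/-! ### Discontinuous groups and Schottky groups -/

/-- The projective line `ℙ¹(K)`. -/
abbrev P1 (K : Type*) [Field K] : Type _ := ℙ K (Fin 2 → K)

/-- The quotient topology on the projective line, from `K² ∖ {0} → ℙ¹(K)`. -/
instance instTopologicalSpaceP1 (K : Type*) [Field K] [TopologicalSpace K] :
    TopologicalSpace (P1 K) :=
  TopologicalSpace.coinduced
    (fun v : {v : Fin 2 → K // v ≠ 0} => Projectivization.mk K v.1 v.2) inferInstance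

/-- The point `[z : 1]` of the projective line. -/
def affinePoint {K : Type*} [Field K] (z : K) : P1 K :=
  Projectivization.mk K ![z, 1] (fun h => one_ne_zero (congrFun h 1))

/-- The point `∞ = [1 : 0]` of the projective line. -/
def infinityPoint (K : Type*) [Field K] : P1 K :=
  Projectivization.mk K ![1, 0] (fun h => one_ne_zero (congrFun h 0))

section Discontinuous

variable {K : Type*} [Field K] [TopologicalSpace K]

/-- The set of limit points of `G`: all `x = lim γₙ y` with `γₙ ∈ G` pairwise different. -/
def limitSet (G : Subgroup PGL(2, K)) : Set (P1 K) :=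
  {x | ∃ (γ : ℕ → PGL(2, K)) (y : P1 K), Function.Injective γ ∧ (∀ n, γ n ∈ G) ∧
    Filter.Tendsto (fun n => γ n • y) Filter.atTop (nhds x)}

/-- The domain `Ω(G)`, the complement of the set of limit points. -/
def ordinarySet (G : Subgroup PGL(2, K)) : Set (P1 K) := (limitSet G)ᶜ

/-- `Ω(G)` is nonempty and all orbits in `ℙ¹(K)` have compact closure. -/
def IsDiscontinuous (G : Subgroup PGL(2, K)) : Prop :=
  (ordinarySet G).Nonempty ∧ ∀ x : P1 K, IsCompact (closure (MulAction.orbit G x))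

/-- A Schottky group: discontinuous, finitely generated, without non-trivial elements of finite
order. -/
def IsSchottky (G : Subgroup PGL(2, K)) : Prop :=
  IsDiscontinuous G ∧ G.FG ∧ ∀ g ∈ G, IsOfFinOrder g → g = 1

end Discontinuous

/-! ### Fixed points and the field `k` -/

/-- The set `F(G)` of the fixed points in `ℙ¹(K)` of the non-trivial elements of `G`. -/
def fixedPointSet {K : Type*} [Field K] (G : Subgroup PGL(2, K)) : Set (P1 K) :=
  {P | ∃ g ∈ G, g ≠ 1 ∧ g • P = P}

/-- `g` is elliptic: its two eigenvalues are different and have the same absolute value. -/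
def IsElliptic {K : Type*} [NormedField K] (g : PGL(2, K)) : Prop :=
  ∃ (A : GL (Fin 2) K) (a b : K), Matrix.ProjGenLinGroup.mk A = g ∧ a ≠ b ∧ ‖a‖ = ‖b‖ ∧
    A.1.charpoly = (Polynomial.X - Polynomial.C a) * (Polynomial.X - Polynomial.C b)

variable {p : ℕ} [Fact p.Prime]

/-- `k` is a field over which the tree of `G` is constructed: the extension of `ℚ_[p]` generated
by the coefficients of (matrices representing) finitely many generators of `G` and by the fixed
points of representatives of the conjugacy classes of elliptic elements of `G`. -/
def IsTreeField (G : Subgroup PGL(2, ℂ_[p])) (k : IntermediateField ℚ_[p] ℂ_[p]) : Prop :=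
  ∃ (gens : Finset (GL (Fin 2) ℂ_[p])) (reps : Set PGL(2, ℂ_[p])),
    Subgroup.closure (Matrix.ProjGenLinGroup.mk '' (gens : Set (GL (Fin 2) ℂ_[p]))) = G ∧
    (∀ r ∈ reps, r ∈ G ∧ IsElliptic r) ∧
    (∀ g ∈ G, IsElliptic g → ∃! r, r ∈ reps ∧ ∃ h ∈ G, h * g * h⁻¹ = r) ∧
    k = IntermediateField.adjoin ℚ_[p]
      ({z | ∃ A ∈ gens, ∃ i j, z = A.1 i j} ∪
        {z | ∃ r ∈ reps, r • affinePoint z = affinePoint z})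

/-! ### The tree of balls -/

/-- The set `|k^×|` of absolute values of `k`. -/
def absValues (k : IntermediateField ℚ_[p] ℂ_[p]) : Set ℝ :=
  {r | ∃ c : k, c ≠ 0 ∧ ‖c‖ = r}

/-- The vertices of the Bruhat-Tits tree of `k`: the balls `B(x, r) ⊆ k` with `x ∈ k` and
`r ∈ |k^×|`. -/
def BallVertex (k : IntermediateField ℚ_[p] ℂ_[p]) : Type :=
  {B : Set k // ∃ x : k, ∃ r ∈ absValues k, B = Metric.closedBall x r}

/-- The Bruhat-Tits tree of `k`: `B(x, r)` and `B(x', r')` are joined by an edge if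
`B(x, r) ⊂ B(x', r')` and `[r, r'] ∩ |k^×| = {r, r'}`, or vice versa. -/
def bruhatTitsTree (k : IntermediateField ℚ_[p] ℂ_[p]) : SimpleGraph (BallVertex k) :=
  SimpleGraph.fromRel fun B B' => ∃ (x x' : k) (r r' : ℝ),
    r ∈ absValues k ∧ r' ∈ absValues k ∧
    B.1 = Metric.closedBall x r ∧ B'.1 = Metric.closedBall x' r' ∧ B.1 ⊂ B'.1 ∧
    Set.Icc r r' ∩ absValues k = {r, r'}

/-- The vertices of the path joining the ends `P ≠ Q` of the Bruhat-Tits tree: for `P = a` and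
`Q = b` in the affine line, these are the balls of radius at most `|a - b|` around `a` or `b`; for
`P = a` and `Q = ∞`, these are all balls around `a`. -/
def endPath (k : IntermediateField ℚ_[p] ℂ_[p]) (P Q : P1 ℂ_[p]) : Set (BallVertex k) :=
  {B | ∃ (x : k) (r : ℝ), r ∈ absValues k ∧ B.1 = Metric.closedBall x r ∧
    ((∃ a b : ℂ_[p], P = affinePoint a ∧ Q = affinePoint b ∧
        r ≤ ‖a - b‖ ∧ (‖a - x‖ ≤ r ∨ ‖b - x‖ ≤ r)) ∨
      (∃ a : ℂ_[p], P = affinePoint a ∧ Q = infinityPoint ℂ_[p] ∧ ‖a - x‖ ≤ r) ∨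
      (∃ a : ℂ_[p], P = infinityPoint ℂ_[p] ∧ Q = affinePoint a ∧ ‖a - x‖ ≤ r))}

/-- The subtree `𝒯*(G)` of the Bruhat-Tits tree of `k` generated by the ends in `F(G)`: the union
of the paths joining two different points of `F(G)`. -/
def starTree (G : Subgroup PGL(2, ℂ_[p])) (k : IntermediateField ℚ_[p] ℂ_[p]) :
    (bruhatTitsTree k).Subgraph :=
  (⊤ : (bruhatTitsTree k).Subgraph).induce
    {B | ∃ P ∈ fixedPointSet G, ∃ Q ∈ fixedPointSet G, P ≠ Q ∧ B ∈ endPath k P Q}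

/-! ### The action on the tree

The ball `B` corresponds to the homothety class of the lattice generated by the vectors `(y, 1)`
with `y ∈ B`; the group `PGL₂` acts on homothety classes of lattices. -/

/-- `𝓞`-submodules of `ℂ_[p]²`. -/
abbrev Sub (p : ℕ) [Fact p.Prime] : Type := Submodule 𝓞_ℂ_[p] (Fin 2 → ℂ_[p])

/-- The image `g L` of an `𝓞`-submodule under an invertible matrix. -/
def moveSub (g : GL (Fin 2) ℂ_[p]) (L : Sub p) : Sub p :=
  L.map ((Matrix.mulVecLin g.1).restrictScalars 𝓞_ℂ_[p])

theorem moveSub_one (L : Sub p) : moveSub 1 L = L := by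
  ext v
  simp [moveSub]

theorem moveSub_mul (g h : GL (Fin 2) ℂ_[p]) (L : Sub p) :
    moveSub (g * h) L = moveSub g (moveSub h L) := by
  ext v
  simp [moveSub]

/-- The homothety relation on `𝓞`-submodules of `ℂ_[p]²`: `L ∼ c L` for `c ≠ 0`. -/
def homothety (p : ℕ) [Fact p.Prime] : Setoid (Sub p) where
  r L L' := ∃ c : (ℂ_[p])ˣ, L' = moveSub (Matrix.GeneralLinearGroup.scalar (Fin 2) c) L
  iseqv :=
    { refl := fun L => ⟨1, by rw [map_one, moveSub_one]⟩
      symm := by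
        rintro L _ ⟨c, rfl⟩
        exact ⟨c⁻¹, by rw [← moveSub_mul, ← map_mul, inv_mul_cancel, map_one, moveSub_one]⟩
      trans := by
        rintro L _ _ ⟨c, rfl⟩ ⟨d, rfl⟩
        exact ⟨d * c, by rw [← moveSub_mul, ← map_mul]⟩ }

/-- Homothety classes of `𝓞`-submodules of `ℂ_[p]²`. -/
def LatticeClass (p : ℕ) [Fact p.Prime] : Type := Quotient (homothety p)

instance instMulActionGLLatticeClass : MulAction (GL (Fin 2) ℂ_[p]) (LatticeClass p) where
  smul g := Quotient.map (moveSub g) (by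
    rintro L _ ⟨c, rfl⟩
    refine ⟨c, ?_⟩
    have h : g * Matrix.GeneralLinearGroup.scalar (Fin 2) c =
        Matrix.GeneralLinearGroup.scalar (Fin 2) c * g := by
      ext i j
      simp [mul_comm]
    rw [← moveSub_mul, ← moveSub_mul, h])
  one_smul := by
    rintro ⟨L⟩
    exact congrArg (Quotient.mk (homothety p)) (moveSub_one L)
  mul_smul g h := by
    rintro ⟨L⟩
    exact congrArg (Quotient.mk (homothety p)) (moveSub_mul g h L)

/-- Scalar matrices act trivially on homothety classes, so `PGL₂` acts. -/
instance instMulActionPGLLatticeClass : MulAction PGL(2, ℂ_[p]) (LatticeClass p) :=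
  Matrix.ProjGenLinGroup.mulActionOfGL (by
    rintro c ⟨L⟩
    exact (Quotient.sound (s := homothety p) ⟨c, rfl⟩).symm)

/-- The homothety class of the lattice belonging to a ball. -/
def BallVertex.latticeClass {k : IntermediateField ℚ_[p] ℂ_[p]} (B : BallVertex k) :
    LatticeClass p :=
  Quotient.mk (homothety p)
    (Submodule.span 𝓞_ℂ_[p] ((fun y : k => (![(y : ℂ_[p]), 1] : Fin 2 → ℂ_[p])) '' B.1))

/-! ### The quotient graph and its vertex groups -/

/-- Two vertices of `𝒯*(G)` are equivalent if an element of `G` maps one to the other. -/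
def starTreeOrbit (G : Subgroup PGL(2, ℂ_[p])) (k : IntermediateField ℚ_[p] ℂ_[p]) :
    Setoid (starTree G k).verts :=
  (MulAction.orbitRel G (LatticeClass p)).comap fun B => B.1.latticeClass

/-- The vertices of the quotient graph `𝒢*(G) = 𝒯*(G)/G`. -/
def QuotientVertex (G : Subgroup PGL(2, ℂ_[p])) (k : IntermediateField ℚ_[p] ℂ_[p]) : Type :=
  Quotient (starTreeOrbit G k)

/-- The vertex groups of `𝒢*(G)` at the vertex `v`: the conjugacy class of subgroups of `G` formed
by the stabilizers in `G` of the vertices of `𝒯*(G)` above `v`. -/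
def vertexGroups {G : Subgroup PGL(2, ℂ_[p])} {k : IntermediateField ℚ_[p] ℂ_[p]}
    (v : QuotientVertex G k) : Set (Subgroup G) :=
  {S | ∃ B : (starTree G k).verts, Quotient.mk (starTreeOrbit G k) B = v ∧
    S = MulAction.stabilizer G B.1.latticeClass}

end

end DiscontinuousGroups

/-!
Since `φ.ker` has finite index in the finitely generated group `G`, it is finitely generated, and
discontinuity passes to subgroups. Hence `φ.ker` is a Schottky group if and only if it contains no
non-trivial element of finite order. The theorem follows by comparing the elements of finite order
with the elements fixing a vertex.

* Every element of the stabilizer of a vertex has finite order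
  (`IsDiscontinuous.isOfFinOrder_of_mem_stabilizer`). In a basis of the lattice it is given by a
  matrix `M ∈ GL₂(𝓞)`. As the residue field of `ℂ_[p]` is algebraic over a finite field, some power
  `M ^ m` is congruent to `1` modulo the maximal ideal, and then `M ^ (m p ^ n) → 1`. If the order
  were infinite, these would be pairwise different elements of the group, and every point of the
  projective line would be a limit point. This needs no local compactness of `k`.
* Every non-trivial element of finite order in `G` fixes a vertex of `𝒯*(G)`
  (`IsTreeField.exists_smul_latticeClass_eq`). It is diagonalizable with two different eigenvalues of
  the same absolute value, so it is elliptic. Its two fixed points are `k`-rational, because those of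
  the representative of its conjugacy class are and `G` has coefficients in `k`. On the path joining
  them lies a vertex whose lattice is generated by two eigenvectors, and this vertex is fixed.
-/

namespace DiscontinuousGroups

open Matrix Filter Topology
open scoped Pointwise

/-! ### Subgroups of discontinuous groups, and limit points -/

section Discontinuous

variable {K : Type*} [Field K] [TopologicalSpace K]

theorem limitSet_mono {G G' : Subgroup PGL(2, K)} (h : G' ≤ G) : limitSet G' ⊆ limitSet G := by
  rintro x ⟨γ, y, hγ, hmem, hlim⟩
  exact ⟨γ, y, hγ, fun n => h (hmem n), hlim⟩

theorem IsDiscontinuous.mono {G G' : Subgroup PGL(2, K)} (hG : IsDiscontinuous G) (h : G' ≤ G) :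
    IsDiscontinuous G' := by
  refine ⟨hG.1.mono (Set.compl_subset_compl.2 (limitSet_mono h)), fun x => ?_⟩
  refine (hG.2 x).of_isClosed_subset isClosed_closure (closure_mono ?_)
  rintro _ ⟨g, rfl⟩
  exact ⟨⟨g.1, h g.2⟩, rfl⟩

theorem tendsto_mk_smul [IsTopologicalRing K] {ι : Type*} {l : Filter ι} {A : ι → GL (Fin 2) K}
    (hA : Tendsto (fun n => (A n).1) l (𝓝 1)) (y : P1 K) :
    Tendsto (fun n => ProjGenLinGroup.mk (A n) • y) l (𝓝 y) := by
  induction y using Projectivization.ind with | _ v hv =>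
  have hmk : Continuous (fun v : {v : Fin 2 → K // v ≠ 0} => Projectivization.mk K v.1 v.2) :=
    continuous_coinduced_rng
  have hlim : Tendsto (fun n => (⟨A n • v, (smul_ne_zero_iff_ne (A n)).2 hv⟩ :
      {v : Fin 2 → K // v ≠ 0})) l (𝓝 ⟨v, hv⟩) := by
    rw [tendsto_subtype_rng]
    have h : Continuous (fun M : Matrix (Fin 2) (Fin 2) K => M *ᵥ v) := by fun_prop
    have h' := (h.tendsto 1).comp hA
    rw [one_mulVec] at h'
    exact h'
  exact (hmk.tendsto _).comp hlim

/-- In a group with a non-limit point, no sequence of pairwise different elements can be lifted to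
matrices converging to the identity: every point would be a limit point. -/
theorem IsDiscontinuous.not_tendsto_one [IsTopologicalRing K] {G : Subgroup PGL(2, K)}
    (hG : IsDiscontinuous G) {A : ℕ → GL (Fin 2) K}
    (hinj : Function.Injective fun n => ProjGenLinGroup.mk (A n))
    (hmem : ∀ n, ProjGenLinGroup.mk (A n) ∈ G) : ¬ Tendsto (fun n => (A n).1) atTop (𝓝 1) := by
  intro hA
  obtain ⟨y, hy⟩ := hG.1
  exact hy ⟨_, y, hinj, hmem, tendsto_mk_smul hA y⟩

end Discontinuous

/-- Schreier's lemma for the kernel of a homomorphism to a finite group. -/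
theorem fg_map_ker {P H : Type*} [Group P] [Group H] [Finite H] {G : Subgroup P} (hG : G.FG)
    (φ : G →* H) : (φ.ker.map G.subtype).FG := by
  have : Group.FG G := (Group.fg_iff_subgroup_fg G).2 hG
  have hker : φ.ker.FG := (Group.fg_iff_subgroup_fg _).1 (Subgroup.fg_of_index_ne_zero φ.ker)
  rw [Subgroup.fg_iff_submonoid_fg] at hker ⊢
  exact hker.map G.subtype

/-! ### Powers of integral matrices -/

section Ultrametric

variable {K : Type*} [NormedField K] {n : Type*}

theorem norm_one_apply_le [DecidableEq n] (i j : n) : ‖(1 : Matrix n n K) i j‖ ≤ 1 := by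
  rw [one_apply]
  split_ifs <;> simp

variable [IsUltrametricDist K]

theorem norm_add_apply_le {A B : Matrix n n K} {s : ℝ}
    (hA : ∀ i j, ‖A i j‖ ≤ s) (hB : ∀ i j, ‖B i j‖ ≤ s) (i j : n) : ‖(A + B) i j‖ ≤ s :=
  (IsUltrametricDist.norm_add_le_max _ _).trans (max_le (hA i j) (hB i j))

variable [Fintype n]

theorem norm_mul_apply_le {A B : Matrix n n K} {s t : ℝ} (hs : 0 ≤ s) (ht : 0 ≤ t)
    (hA : ∀ i j, ‖A i j‖ ≤ s) (hB : ∀ i j, ‖B i j‖ ≤ t) (i j : n) : ‖(A * B) i j‖ ≤ s * t := by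
  rw [mul_apply]
  refine IsUltrametricDist.norm_sum_le_of_forall_le_of_nonneg (mul_nonneg hs ht) fun l _ => ?_
  rw [norm_mul]
  exact mul_le_mul (hA i l) (hB l j) (norm_nonneg _) hs

variable [DecidableEq n]

theorem norm_pow_apply_le {A : Matrix n n K} (hA : ∀ i j, ‖A i j‖ ≤ 1) (m : ℕ) (i j : n) :
    ‖(A ^ m) i j‖ ≤ 1 := by
  induction m generalizing i j with
  | zero => simpa using norm_one_apply_le i j
  | succ m ih =>
    rw [pow_succ]
    simpa using norm_mul_apply_le zero_le_one zero_le_one ih hA i j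

theorem norm_pow_sub_pow_apply_le {A B : Matrix n n K} {s : ℝ} (hs : 0 ≤ s)
    (hA : ∀ i j, ‖A i j‖ ≤ 1) (hB : ∀ i j, ‖B i j‖ ≤ 1) (hAB : ∀ i j, ‖(A - B) i j‖ ≤ s)
    (m : ℕ) (i j : n) : ‖(A ^ m - B ^ m) i j‖ ≤ s := by
  induction m generalizing i j with
  | zero => simpa using hs
  | succ m ih =>
    have h : A ^ (m + 1) - B ^ (m + 1) = (A ^ m - B ^ m) * A + B ^ m * (A - B) := by noncomm_ring
    rw [h]
    refine norm_add_apply_le (fun i j => ?_) (fun i j => ?_) i j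
    · simpa using norm_mul_apply_le hs zero_le_one ih hA i j
    · simpa using norm_mul_apply_le zero_le_one hs (norm_pow_apply_le hB m) hAB i j

/-- If `A ≡ 1` modulo elements of norm `≤ s`, then `A ^ p ≡ 1` modulo elements of norm `≤ s r`,
where `s, |p| ≤ r`: in `A ^ p - 1 = (A - 1) (1 + A + ⋯ + A ^ (p - 1))`, the second factor is
congruent to `p`. -/
theorem norm_pow_sub_one_apply_le {A : Matrix n n K} {p : ℕ} {s r : ℝ} (hs : 0 ≤ s) (hs1 : s ≤ 1)
    (hsr : s ≤ r) (hpr : ‖(p : K)‖ ≤ r) (hA : ∀ i j, ‖(A - 1) i j‖ ≤ s) (i j : n) :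
    ‖(A ^ p - 1) i j‖ ≤ s * r := by
  have hr : 0 ≤ r := hs.trans hsr
  have hA1 : ∀ i j, ‖A i j‖ ≤ 1 := fun i j => by
    simpa using norm_add_apply_le (fun i j => (hA i j).trans hs1) norm_one_apply_le i j
  have hsum : ∑ l ∈ Finset.range p, A ^ l
      = ∑ l ∈ Finset.range p, (A ^ l - 1) + (p : K) • (1 : Matrix n n K) := by
    rw [Finset.sum_sub_distrib]
    simp [← Nat.cast_smul_eq_nsmul K]
  rw [← mul_geom_sum, hsum]
  refine norm_mul_apply_le hs hr hA (norm_add_apply_le (fun i j => ?_) fun i j => ?_) i j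
  · rw [Matrix.sum_apply]
    refine IsUltrametricDist.norm_sum_le_of_forall_le_of_nonneg hr fun l _ => ?_
    have h := norm_pow_sub_pow_apply_le hs hA1 norm_one_apply_le hA l i j
    rw [one_pow] at h
    exact h.trans hsr
  · rw [Matrix.smul_apply, smul_eq_mul, norm_mul]
    exact (mul_le_of_le_one_right (norm_nonneg _) (norm_one_apply_le i j)).trans hpr

/-- A matrix congruent to `1` modulo elements of norm `< 1` has `p`-power iterates
tending to `1`: each `p`-th power gains a factor `r < 1`. -/
theorem tendsto_pow_pow_one {A : Matrix n n K} {p : ℕ} (hp : ‖(p : K)‖ < 1)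
    (hA : ∀ i j, ‖(A - 1) i j‖ < 1) : Tendsto (fun m => A ^ p ^ m) atTop (𝓝 1) := by
  obtain ⟨r, hr0, hr1, hpr, hAr⟩ :
      ∃ r : ℝ, 0 ≤ r ∧ r < 1 ∧ ‖(p : K)‖ ≤ r ∧ ∀ i j, ‖(A - 1) i j‖ ≤ r := by
    let f : Option (n × n) → ℝ := fun o => o.elim ‖(p : K)‖ fun x => ‖(A - 1) x.1 x.2‖
    obtain ⟨o, ho⟩ := Finite.exists_max f
    refine ⟨f o, (norm_nonneg _).trans (ho none), ?_, ho none, fun i j => ho (some (i, j))⟩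
    cases o with
    | none => exact hp
    | some x => exact hA x.1 x.2
  have key : ∀ m i j, ‖(A ^ p ^ m - 1) i j‖ ≤ r ^ (m + 1) := by
    intro m
    induction m with
    | zero => simpa using hAr
    | succ m ih =>
      intro i j
      rw [pow_succ, pow_mul, pow_succ r]
      exact norm_pow_sub_one_apply_le (pow_nonneg hr0 _) (pow_le_one₀ hr0 hr1.le)
        (pow_le_of_le_one hr0 hr1.le (Nat.succ_ne_zero m)) hpr ih i j
  refine tendsto_pi_nhds.2 fun i => tendsto_pi_nhds.2 fun j => ?_
  rw [tendsto_iff_norm_sub_tendsto_zero]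
  exact squeeze_zero (fun _ => norm_nonneg _) (fun m => key m i j)
    ((tendsto_pow_atTop_nhds_zero_of_lt_one hr0 hr1).comp (tendsto_add_atTop_nat 1))

end Ultrametric

section Padic

variable {p : ℕ} [Fact p.Prime]

theorem norm_natCast_self_lt_one : ‖(p : ℂ_[p])‖ < 1 := by
  have h := PadicComplex.norm_extends' p (p : ℚ_[p])
  have h2 : (((p : ℚ_[p]) : PadicAlgCl p) : ℂ_[p]) = (p : ℂ_[p]) := by simp
  rw [h2] at h
  rw [h]
  exact Padic.norm_p_lt_one

/-- A matrix with entries of norm `≤ 1` has two different powers that are congruent modulo elements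
of norm `< 1`. Approximating the entries, one may assume them algebraic over `ℚ_[p]`; then all powers
lie in a compact set. -/
theorem exists_norm_pow_sub_pow_lt_one {n : Type*} [Fintype n] [DecidableEq n]
    {A : Matrix n n ℂ_[p]} (hA : ∀ i j, ‖A i j‖ ≤ 1) :
    ∃ a b : ℕ, a < b ∧ ∀ i j, ‖(A ^ b - A ^ a) i j‖ < 1 := by
  have hdense : ∀ z : ℂ_[p], ∃ w : PadicAlgCl p, ‖z - (w : ℂ_[p])‖ < 1 := fun z => by
    obtain ⟨w, hw⟩ := UniformSpace.Completion.denseRange_coe.exists_dist_lt z one_pos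
    exact ⟨w, by rwa [dist_eq_norm] at hw⟩
  choose f hf using hdense
  let B : Matrix n n ℂ_[p] := fun i j => (f (A i j) : ℂ_[p])
  have hAB : ∀ i j, ‖(A - B) i j‖ < 1 := fun i j => hf (A i j)
  have hB : ∀ i j, ‖B i j‖ ≤ 1 := fun i j => by
    have h := IsUltrametricDist.norm_add_le_max (A i j) (-(A - B) i j)
    rw [norm_neg] at h
    simpa using h.trans (max_le (hA i j) (hAB i j).le)
  -- The approximating matrix has its powers over a finite-dimensional, hence locally compact, algebra.
  let V := Algebra.adjoin ℚ_[p] (Set.range fun x : n × n => B x.1 x.2)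
  have hfin : FiniteDimensional ℚ_[p] V := by
    refine Module.Finite.iff_fg.2 (fg_adjoin_of_finite (Set.finite_range _) ?_)
    rintro _ ⟨x, rfl⟩
    exact (Algebra.IsIntegral.isIntegral (R := ℚ_[p]) (f (A x.1 x.2))).map
      (IsScalarTower.toAlgHom ℚ_[p] (PadicAlgCl p) ℂ_[p])
  have : ProperSpace V := FiniteDimensional.proper ℚ_[p] V
  let B' : Matrix n n V := fun i j => ⟨B i j, Algebra.subset_adjoin ⟨(i, j), rfl⟩⟩
  have hB' : ∀ m i j, ((B' ^ m) i j : ℂ_[p]) = (B ^ m) i j := fun m i j => by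
    have h : B = V.val.mapMatrix B' := rfl
    rw [h, ← map_pow]
    rfl
  have hmem : ∀ m, (fun i j => (B' ^ m) i j : n → n → V) ∈ Metric.closedBall 0 1 := fun m => by
    rw [mem_closedBall_zero_iff]
    refine (pi_norm_le_iff_of_nonneg zero_le_one).2 fun i =>
      (pi_norm_le_iff_of_nonneg zero_le_one).2 fun j => ?_
    change ‖((B' ^ m) i j : ℂ_[p])‖ ≤ 1
    rw [hB']
    exact norm_pow_apply_le hB m i j
  obtain ⟨_, _, u, hu, hlim⟩ := (isCompact_closedBall _ _).tendsto_subseq hmem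
  obtain ⟨N, hN⟩ := Metric.cauchySeq_iff.1 hlim.cauchySeq 1 one_pos
  refine ⟨u N, u (N + 1), hu N.lt_succ_self, fun i j => ?_⟩
  have hclose := hN (N + 1) N.le_succ N le_rfl
  rw [dist_eq_norm] at hclose
  have hBij : ‖(B ^ u (N + 1) - B ^ u N) i j‖ < 1 := by
    have h := (pi_norm_lt_iff one_pos).1 ((pi_norm_lt_iff one_pos).1 hclose i) j
    change ‖((B' ^ u (N + 1)) i j : ℂ_[p]) - ((B' ^ u N) i j : ℂ_[p])‖ < 1 at h
    rwa [hB', hB'] at h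
  have hs : ∀ m, ‖(A ^ m - B ^ m) i j‖ < 1 := fun m => by
    have : Nonempty (n × n) := ⟨(i, j)⟩
    obtain ⟨x, hx⟩ := Finite.exists_max fun x : n × n => ‖(A - B) x.1 x.2‖
    exact (norm_pow_sub_pow_apply_le (norm_nonneg _) hA hB (fun i j => hx (i, j)) m i j).trans_lt
      (hAB x.1 x.2)
  have heq : (A ^ u (N + 1) - A ^ u N) i j = (A ^ u (N + 1) - B ^ u (N + 1)) i j +
      ((B ^ u (N + 1) - B ^ u N) i j + -(A ^ u N - B ^ u N) i j) := by
    simp only [Matrix.sub_apply]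
    ring
  rw [heq]
  refine (IsUltrametricDist.norm_add_le_max _ _).trans_lt (max_lt (hs _) ?_)
  refine (IsUltrametricDist.norm_add_le_max _ _).trans_lt (max_lt hBij ?_)
  rw [norm_neg]
  exact hs _

/-- An element of `GL₂` of the ring of integers of `ℂ_[p]` has a power congruent to `1` modulo the
maximal ideal. -/
theorem exists_pow_sub_one_norm_lt_one {M : GL (Fin 2) ℂ_[p]} (hM : ∀ i j, ‖M.1 i j‖ ≤ 1)
    (hM' : ∀ i j, ‖(M⁻¹).1 i j‖ ≤ 1) :
    ∃ m : ℕ, 0 < m ∧ ∀ i j, ‖((M ^ m).1 - 1) i j‖ < 1 := by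
  obtain ⟨a, b, hab, h⟩ := exists_norm_pow_sub_pow_lt_one hM
  refine ⟨b - a, Nat.sub_pos_of_lt hab, fun i j => ?_⟩
  obtain ⟨x, hx⟩ := Finite.exists_max fun x : Fin 2 × Fin 2 => ‖(M.1 ^ b - M.1 ^ a) x.1 x.2‖
  have heq : (M ^ (b - a)).1 - 1 = (M⁻¹).1 ^ a * (M.1 ^ b - M.1 ^ a) := by
    have h1 : M ^ (b - a) = M⁻¹ ^ a * M ^ b := by
      rw [pow_sub M hab.le, ← inv_pow]
      exact ((Commute.refl M).inv_right.pow_pow _ _).eq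
    have h2 : M⁻¹ ^ a * M ^ a = 1 := by simp
    rw [mul_sub, ← Units.val_pow_eq_pow_val, ← Units.val_pow_eq_pow_val,
      ← Units.val_pow_eq_pow_val, ← Units.val_mul, ← Units.val_mul, h1, h2]
    rfl
  rw [heq]
  refine (norm_mul_apply_le zero_le_one (norm_nonneg _) (norm_pow_apply_le hM' a)
    (fun i j => hx (i, j)) i j).trans_lt ?_
  rw [one_mul]
  exact h x.1 x.2

end Padic

/-! ### Lattices and stabilizers of vertices -/

section Lattices

variable {p : ℕ} [Fact p.Prime]

theorem mem_integers_iff {z : ℂ_[p]} : z ∈ 𝓞_ℂ_[p] ↔ ‖z‖ ≤ 1 := by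
  rw [PadicComplex.norm_eq_norm]
  exact (Valued.toNormedField.norm_le_one_iff (L := ℂ_[p])).symm

theorem smul_mem_of_norm_le_one {L : Sub p} {v : Fin 2 → ℂ_[p]} (hv : v ∈ L) {z : ℂ_[p]}
    (hz : ‖z‖ ≤ 1) : z • v ∈ L :=
  L.smul_mem (⟨z, mem_integers_iff.2 hz⟩ : 𝓞_ℂ_[p]) hv

theorem left_mem_span_pair (v w : Fin 2 → ℂ_[p]) : v ∈ Submodule.span 𝓞_ℂ_[p] {v, w} :=
  Submodule.subset_span (Set.mem_insert _ _)

theorem right_mem_span_pair (v w : Fin 2 → ℂ_[p]) : w ∈ Submodule.span 𝓞_ℂ_[p] {v, w} :=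
  Submodule.subset_span (Set.mem_insert_of_mem _ rfl)

/-- The homothety class of the submodule generated by two vectors. -/
noncomputable def spanClass (v w : Fin 2 → ℂ_[p]) : LatticeClass p :=
  Quotient.mk (homothety p) (Submodule.span 𝓞_ℂ_[p] {v, w})

theorem moveSub_span_pair (A : GL (Fin 2) ℂ_[p]) (v w : Fin 2 → ℂ_[p]) :
    moveSub A (Submodule.span 𝓞_ℂ_[p] {v, w}) =
      Submodule.span 𝓞_ℂ_[p] {A.1 *ᵥ v, A.1 *ᵥ w} := by
  rw [moveSub, Submodule.map_span, Set.image_pair]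
  rfl

/-- A matrix stabilizing the lattice `𝓞²` has integral entries. -/
theorem norm_apply_le_of_moveSub_eq {M : GL (Fin 2) ℂ_[p]}
    (hM : moveSub M (Submodule.span 𝓞_ℂ_[p] {![1, 0], ![0, 1]}) =
      Submodule.span 𝓞_ℂ_[p] {![1, 0], ![0, 1]}) (i j : Fin 2) : ‖M.1 i j‖ ≤ 1 := by
  have hstd : ∀ v ∈ Submodule.span 𝓞_ℂ_[p] {(![1, 0] : Fin 2 → ℂ_[p]), ![0, 1]},
      ∀ i, ‖v i‖ ≤ 1 := by
    intro v hv i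
    obtain ⟨a, b, rfl⟩ := Submodule.mem_span_pair.1 hv
    have h : a • (![1, 0] : Fin 2 → ℂ_[p]) + b • ![0, 1] = ![(a : ℂ_[p]), (b : ℂ_[p])] := by
      ext i
      fin_cases i
      · change (a : ℂ_[p]) * 1 + (b : ℂ_[p]) * 0 = a
        ring
      · change (a : ℂ_[p]) * 0 + (b : ℂ_[p]) * 1 = b
        ring
    rw [h]
    fin_cases i
    · exact mem_integers_iff.1 a.2
    · exact mem_integers_iff.1 b.2
  rw [moveSub_span_pair] at hM
  have h0 := hstd _ (hM.le (left_mem_span_pair _ _)) i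
  have h1 := hstd _ (hM.le (right_mem_span_pair _ _)) i
  fin_cases j
  · simpa [mulVec, dotProduct] using h0
  · simpa [mulVec, dotProduct] using h1

theorem moveSub_inv_eq {A : GL (Fin 2) ℂ_[p]} {L L' : Sub p} (h : moveSub A L = L') :
    moveSub A⁻¹ L' = L := by
  rw [← h, ← moveSub_mul, inv_mul_cancel, moveSub_one]

/-- The stabilizer in a discontinuous group of the class of a lattice is a torsion group: for an
element of it, suitable powers tend to `1`. -/
theorem IsDiscontinuous.isOfFinOrder_of_smul_eq {G : Subgroup PGL(2, ℂ_[p])}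
    (hG : IsDiscontinuous G) {g : PGL(2, ℂ_[p])} (hg : g ∈ G) (P : GL (Fin 2) ℂ_[p])
    (hfix : g • spanClass (P.1 *ᵥ ![1, 0]) (P.1 *ᵥ ![0, 1]) =
      spanClass (P.1 *ᵥ ![1, 0]) (P.1 *ᵥ ![0, 1])) : IsOfFinOrder g := by
  by_contra hord
  obtain ⟨A, rfl⟩ := ProjGenLinGroup.mk_surjective g
  obtain ⟨c, hc⟩ := Quotient.exact (s := homothety p) hfix
  rw [← moveSub_span_pair, ← moveSub_mul] at hc
  -- In the basis given by the columns of `P`, the scalar multiple `c A` of `A` preserves `𝓞²`.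
  let M : GL (Fin 2) ℂ_[p] := P⁻¹ * (GeneralLinearGroup.scalar (Fin 2) c * A) * P
  have hM : moveSub M (Submodule.span 𝓞_ℂ_[p] {![1, 0], ![0, 1]}) =
      Submodule.span 𝓞_ℂ_[p] {![1, 0], ![0, 1]} := by
    rw [moveSub_mul, moveSub_mul]
    refine moveSub_inv_eq ?_
    exact hc
  obtain ⟨m, hm, hlt⟩ := exists_pow_sub_one_norm_lt_one (norm_apply_le_of_moveSub_eq hM)
    (norm_apply_le_of_moveSub_eq (moveSub_inv_eq hM))
  have hlim := tendsto_pow_pow_one norm_natCast_self_lt_one hlt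
  have hmk : ∀ n : ℕ, ProjGenLinGroup.mk (P * (M ^ m) ^ n * P⁻¹) = ProjGenLinGroup.mk A ^ (m * n) := by
    intro n
    have h : P * (M ^ m) ^ n * P⁻¹ = (GeneralLinearGroup.scalar (Fin 2) c * A) ^ (m * n) := by
      rw [← pow_mul, ← conj_pow]
      congr 1
      simp only [M]
      group
    rw [h, map_pow, map_mul, ProjGenLinGroup.mk_scalar, one_mul]
  -- The powers `g ^ (m p ^ n)` are pairwise different, but lift to matrices tending to `1`.
  refine hG.not_tendsto_one (A := fun n => P * (M ^ m) ^ p ^ n * P⁻¹) ?_ ?_ ?_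
  · intro a b hab
    simp only [hmk] at hab
    have h := injective_pow_iff_not_isOfFinOrder.2 hord hab
    exact Nat.pow_right_injective (Fact.out : p.Prime).two_le (Nat.eq_of_mul_eq_mul_left hm h)
  · intro n
    rw [hmk]
    exact G.pow_mem hg _
  · have h : Continuous fun X : Matrix (Fin 2) (Fin 2) ℂ_[p] => P.1 * X * (P⁻¹).1 := by fun_prop
    have h' := (h.tendsto 1).comp hlim
    rw [mul_one, ← Units.val_mul, mul_inv_cancel] at h'
    exact h'

variable {k : IntermediateField ℚ_[p] ℂ_[p]}

/-- The lattice belonging to the ball `B(x, |c|)` has the basis `(x, 1), (c, 0)`. -/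
theorem span_image_closedBall (x c : k) (hc : c ≠ 0) :
    Submodule.span 𝓞_ℂ_[p] ((fun y : k => (![(y : ℂ_[p]), 1] : Fin 2 → ℂ_[p])) ''
      Metric.closedBall x ‖c‖) = Submodule.span 𝓞_ℂ_[p] {![(x : ℂ_[p]), 1], ![(c : ℂ_[p]), 0]} := by
  have hc' : (c : ℂ_[p]) ≠ 0 := by simpa using hc
  apply le_antisymm
  · rw [Submodule.span_le]
    rintro _ ⟨y, hy, rfl⟩
    have h : (![(y : ℂ_[p]), 1] : Fin 2 → ℂ_[p]) =
        ![(x : ℂ_[p]), 1] + ((y - x) / c : ℂ_[p]) • ![(c : ℂ_[p]), 0] := by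
      ext i
      fin_cases i <;> simp [hc']
    rw [Metric.mem_closedBall, dist_eq_norm] at hy
    dsimp only
    rw [h]
    refine Submodule.add_mem _ (left_mem_span_pair _ _)
      (smul_mem_of_norm_le_one (right_mem_span_pair _ _) ?_)
    rw [norm_div]
    exact div_le_one_of_le₀ hy (norm_nonneg _)
  · have hx := Submodule.subset_span (R := 𝓞_ℂ_[p])
      (Set.mem_image_of_mem (fun y : k => (![(y : ℂ_[p]), 1] : Fin 2 → ℂ_[p]))
        (Metric.mem_closedBall_self (x := x) (norm_nonneg c)))
    rw [Submodule.span_le, Set.insert_subset_iff, Set.singleton_subset_iff]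
    refine ⟨hx, ?_⟩
    have hxc : x + c ∈ Metric.closedBall x ‖c‖ := by simp
    have h := Submodule.sub_mem _ (Submodule.subset_span (R := 𝓞_ℂ_[p])
      (Set.mem_image_of_mem (fun y : k => (![(y : ℂ_[p]), 1] : Fin 2 → ℂ_[p])) hxc)) hx
    have hsub : (![(c : ℂ_[p]), 0] : Fin 2 → ℂ_[p]) = ![((x + c : k) : ℂ_[p]), 1] - ![(x : ℂ_[p]), 1] := by
      ext i
      fin_cases i <;> simp
    rw [hsub]
    exact h

theorem latticeClass_eq {B : BallVertex k} {x c : k} (hc : c ≠ 0)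
    (hB : B.1 = Metric.closedBall x ‖c‖) : B.latticeClass =
      spanClass ![(x : ℂ_[p]), 1] ![(c : ℂ_[p]), 0] := by
  rw [BallVertex.latticeClass, hB, span_image_closedBall x c hc, spanClass]

theorem IsDiscontinuous.isOfFinOrder_of_mem_stabilizer {G : Subgroup PGL(2, ℂ_[p])}
    (hG : IsDiscontinuous G) {B : BallVertex k} {g : G}
    (hg : g ∈ MulAction.stabilizer G B.latticeClass) : IsOfFinOrder (g : PGL(2, ℂ_[p])) := by
  obtain ⟨x, _, ⟨c, hc, rfl⟩, hB⟩ := B.2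
  have hc' : (c : ℂ_[p]) ≠ 0 := by simpa using hc
  let P : GL (Fin 2) ℂ_[p] := GeneralLinearGroup.mkOfDetNeZero
    !![(x : ℂ_[p]), (c : ℂ_[p]); 1, 0] (by simpa [det_fin_two] using hc)
  have h0 : P.1 *ᵥ ![1, 0] = ![(x : ℂ_[p]), 1] := by
    ext i; fin_cases i <;> simp [P, GeneralLinearGroup.mkOfDetNeZero]
  have h1 : P.1 *ᵥ ![0, 1] = ![(c : ℂ_[p]), 0] := by
    ext i; fin_cases i <;> simp [P, GeneralLinearGroup.mkOfDetNeZero]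
  refine hG.isOfFinOrder_of_smul_eq g.2 P ?_
  rw [h0, h1, ← latticeClass_eq hc hB]
  exact hg

/-- A matrix with eigenvectors `v, w` whose eigenvalues have the same absolute value fixes the
class of the lattice generated by `v` and `w`. -/
theorem mk_smul_span_eigenvectors {A : GL (Fin 2) ℂ_[p]} {a b : ℂ_[p]} (ha : a ≠ 0)
    (hab : ‖a‖ = ‖b‖) {v w : Fin 2 → ℂ_[p]} (hv : A.1 *ᵥ v = a • v) (hw : A.1 *ᵥ w = b • w) :
    ProjGenLinGroup.mk A • spanClass v w = spanClass v w := by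
  have hb : b ≠ 0 := by rwa [← norm_ne_zero_iff, ← hab, norm_ne_zero_iff]
  refine (Quotient.sound (s := homothety p) ⟨Units.mk0 a ha, ?_⟩).symm
  have hscalar : ∀ u : Fin 2 → ℂ_[p],
      (GeneralLinearGroup.scalar (Fin 2) (Units.mk0 a ha)).1 *ᵥ u = a • u := fun u => by
    ext i; fin_cases i <;> simp
  rw [moveSub_span_pair, moveSub_span_pair, hv, hw, hscalar, hscalar]
  apply le_antisymm <;> rw [Submodule.span_le, Set.insert_subset_iff, Set.singleton_subset_iff] <;>
    refine ⟨left_mem_span_pair _ _, ?_⟩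
  · have h : b • w = (b / a) • a • w := by rw [smul_smul, div_mul_cancel₀ _ ha]
    rw [h]
    exact smul_mem_of_norm_le_one (right_mem_span_pair _ _)
      (by rw [norm_div, hab, div_self (norm_ne_zero_iff.2 hb)])
  · have h : a • w = (a / b) • b • w := by rw [smul_smul, div_mul_cancel₀ _ hb]
    rw [h]
    exact smul_mem_of_norm_le_one (right_mem_span_pair _ _)
      (by rw [norm_div, hab, div_self (norm_ne_zero_iff.2 hb)])

end Lattices

/-! ### Elements of finite order -/

/-- A non-scalar matrix with a scalar power is diagonalizable, and its two eigenvalues are different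
and have the same absolute value. -/
theorem exists_eigenvectors_of_pow_eq_scalar {K : Type*} [NormedField K] [IsAlgClosed K] [CharZero K]
    {A : GL (Fin 2) K} {m : ℕ} (hm : 0 < m) {c : Kˣ}
    (hc : A ^ m = GeneralLinearGroup.scalar (Fin 2) c) (hA : ProjGenLinGroup.mk A ≠ 1) :
    ∃ (a b : K) (v w : Fin 2 → K), a ≠ b ∧ ‖a‖ = ‖b‖ ∧ a ≠ 0 ∧ v ≠ 0 ∧ w ≠ 0 ∧
      A.1 *ᵥ v = a • v ∧ A.1 *ᵥ w = b • w ∧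
      A.1.charpoly = (Polynomial.X - Polynomial.C a) * (Polynomial.X - Polynomial.C b) := by
  obtain ⟨a, ha⟩ := IsAlgClosed.exists_root A.1.charpoly (by
    rw [Matrix.charpoly_degree_eq_dim]; simp)
  obtain ⟨b, hab⟩ : ∃ b, a + b = A.1.trace := ⟨A.1.trace - a, by ring⟩
  have hdet : a * b = A.1.det := by
    rw [charpoly_fin_two, Polynomial.IsRoot.def] at ha
    simp at ha
    linear_combination a * hab - ha
  have hchar : A.1.charpoly = (Polynomial.X - Polynomial.C a) * (Polynomial.X - Polynomial.C b) := by
    rw [charpoly_fin_two, ← hab, ← hdet, map_add, map_mul]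
    ring
  have hpow : A.1 ^ m = c.1 • 1 := by
    rw [← Units.val_pow_eq_pow_val, hc]
    ext i j
    simp [Matrix.diagonal_apply, one_apply]
  have heig : ∀ z, A.1.charpoly.IsRoot z → ∃ v, v ≠ 0 ∧ A.1 *ᵥ v = z • v ∧ z ^ m = c := by
    intro z hz
    have h0 : (Matrix.scalar (Fin 2) z - A.1).det = 0 := by
      rw [← Matrix.eval_charpoly]
      exact hz
    obtain ⟨v, hv, hvz⟩ := exists_mulVec_eq_zero_iff.2 h0
    have hvz' : A.1 *ᵥ v = z • v := by
      rw [sub_mulVec, sub_eq_zero] at hvz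
      rw [← hvz]
      ext i
      simp
    have hvm : ∀ l : ℕ, (A.1 ^ l) *ᵥ v = z ^ l • v := fun l => by
      induction l with
      | zero => simp
      | succ l ih => rw [pow_succ, ← mulVec_mulVec, hvz', mulVec_smul, ih, smul_smul, pow_succ']
    have h := hvm m
    rw [hpow, smul_mulVec, one_mulVec] at h
    exact ⟨v, hv, hvz', (smul_left_injective K hv h).symm⟩
  obtain ⟨v, hv, hva, ham⟩ := heig a ha
  obtain ⟨w, hw, hwb, hbm⟩ := heig b (by rw [hchar]; simp)
  refine ⟨a, b, v, w, ?_, ?_, ?_, hv, hw, hva, hwb, hchar⟩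
  · -- With a double eigenvalue, `X - a` would annihilate `A`, since `X ^ m - c` is squarefree.
    rintro rfl
    apply hA
    have hsq : Squarefree (minpoly K A.1) := by
      refine (Polynomial.separable_X_pow_sub_C (c : K) (Nat.cast_ne_zero.2 hm.ne')
        c.ne_zero).squarefree.squarefree_of_dvd (minpoly.dvd K A.1 ?_)
      simp [hpow, Algebra.algebraMap_eq_smul_one]
    have hdvd : minpoly K A.1 ∣ (Polynomial.X - Polynomial.C a) ^ 2 := by
      rw [sq, ← hchar]
      exact minpoly.dvd K A.1 (aeval_self_charpoly _)
    obtain ⟨q, hq⟩ := (hsq.dvd_pow_iff_dvd two_ne_zero).1 hdvd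
    have hAa : A.1 - algebraMap K _ a = 0 := by
      have h := congrArg (Polynomial.aeval A.1) hq
      simpa using h
    have ha0 : a ≠ 0 := by
      rintro rfl
      rw [zero_pow hm.ne'] at ham
      exact c.ne_zero ham.symm
    have hAs : A = GeneralLinearGroup.scalar (Fin 2) (Units.mk0 a ha0) := by
      ext i j
      rw [sub_eq_zero] at hAa
      rw [hAa]
      simp [Algebra.algebraMap_eq_smul_one, Matrix.diagonal_apply, one_apply]
    rw [hAs]
    exact ProjGenLinGroup.mk_scalar _
  · refine (pow_left_inj₀ (norm_nonneg _) (norm_nonneg _) hm.ne').1 ?_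
    rw [← norm_pow, ← norm_pow, ham, hbm]
  · rintro rfl
    rw [zero_pow hm.ne'] at ham
    exact c.ne_zero ham.symm

/-! ### Rational points -/

section Rational

theorem eq_affinePoint_or_eq_infinityPoint {K : Type*} [Field K] (P : P1 K) :
    (∃ z, P = affinePoint z) ∨ P = infinityPoint K := by
  induction P using Projectivization.ind with | _ v hv =>
  by_cases h : v 1 = 0
  · have h0 : v 0 ≠ 0 := fun h0 => hv (by ext i; fin_cases i <;> assumption)
    refine Or.inr ((Projectivization.mk_eq_mk_iff' K _ _ _ _).2 ⟨v 0, ?_⟩)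
    ext i
    fin_cases i <;> simp [h]
  · refine Or.inl ⟨v 0 / v 1, (Projectivization.mk_eq_mk_iff' K _ _ _ _).2 ⟨v 1, ?_⟩⟩
    ext i
    fin_cases i
    · simp [mul_div_cancel₀ _ h]
    · simp

variable {F K : Type*} [Field F] [Field K] [Algebra F K] (k : IntermediateField F K)

/-- The set of `k`-rational points of the projective line over an extension `K` of `k`. -/
def rationalPoints : Set (P1 K) :=
  {P | ∃ (v : Fin 2 → K) (hv : v ≠ 0), (∀ i, v i ∈ k) ∧ P = Projectivization.mk K v hv}

variable {k}

theorem affinePoint_mem_rationalPoints {z : K} : affinePoint z ∈ rationalPoints k ↔ z ∈ k := by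
  constructor
  · rintro ⟨v, hv, hvk, h⟩
    obtain ⟨t, ht⟩ := (Projectivization.mk_eq_mk_iff' K _ _ _ _).1 h.symm
    have h0 : v 0 = t * z := by simp [← ht]
    have h1 : v 1 = t := by simp [← ht]
    have ht0 : t ≠ 0 := by
      rintro rfl
      exact hv (by rw [← ht, zero_smul])
    have hz : z = v 0 / v 1 := by rw [h0, h1, mul_div_cancel_left₀ _ ht0]
    rw [hz]
    exact div_mem (hvk 0) (hvk 1)
  · intro hz
    refine ⟨![z, 1], _, fun i => ?_, rfl⟩
    fin_cases i
    · exact hz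
    · exact one_mem k

variable (k) in
theorem infinityPoint_mem_rationalPoints : infinityPoint K ∈ rationalPoints k := by
  refine ⟨![1, 0], _, fun i => ?_, rfl⟩
  fin_cases i
  · exact one_mem k
  · exact zero_mem k

theorem mk_smul_mem_rationalPoints {A : GL (Fin 2) K} (hA : ∀ i j, A.1 i j ∈ k) {P : P1 K}
    (hP : P ∈ rationalPoints k) : ProjGenLinGroup.mk A • P ∈ rationalPoints k := by
  obtain ⟨v, hv, hvk, rfl⟩ := hP
  refine ⟨A • v, (smul_ne_zero_iff_ne A).2 hv, fun i => ?_, rfl⟩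
  change ∑ j, A.1 i j * v j ∈ k
  exact sum_mem fun j _ => mul_mem (hA i j) (hvk j)

theorem inv_apply_mem {A : GL (Fin 2) K} (hA : ∀ i j, A.1 i j ∈ k) (i j : Fin 2) :
    (A⁻¹).1 i j ∈ k := by
  have hdet : A.1.det ∈ k := by
    rw [det_fin_two]
    exact sub_mem (mul_mem (hA _ _) (hA _ _)) (mul_mem (hA _ _) (hA _ _))
  rw [coe_units_inv, inv_def, adjugate_fin_two, Ring.inverse_eq_inv', Matrix.smul_apply, smul_eq_mul]
  refine mul_mem (inv_mem hdet) ?_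
  fin_cases i <;> fin_cases j
  exacts [hA _ _, neg_mem (hA _ _), neg_mem (hA _ _), hA _ _]

/-- The group generated by matrices with coefficients in `k` permutes the `k`-rational points. -/
theorem smul_mem_rationalPoints {S : Set (GL (Fin 2) K)} (hS : ∀ A ∈ S, ∀ i j, A.1 i j ∈ k)
    {g : PGL(2, K)} (hg : g ∈ Subgroup.closure (ProjGenLinGroup.mk '' S)) {P : P1 K} :
    g • P ∈ rationalPoints k ↔ P ∈ rationalPoints k := by
  have hle : Subgroup.closure (ProjGenLinGroup.mk '' S) ≤
      MulAction.stabilizer PGL(2, K) (rationalPoints k) := by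
    rw [Subgroup.closure_le]
    rintro _ ⟨A, hA, rfl⟩
    refine MulAction.mem_stabilizer_set.2 fun P => ⟨fun h => ?_, mk_smul_mem_rationalPoints (hS A hA)⟩
    have h' := mk_smul_mem_rationalPoints (inv_apply_mem (hS A hA)) h
    rwa [map_inv, inv_smul_smul] at h'
  exact MulAction.mem_stabilizer_set.1 (hle hg) P

end Rational

/-! ### Vertices fixed by elements of finite order -/

variable {p : ℕ} [Fact p.Prime] {k : IntermediateField ℚ_[p] ℂ_[p]}

theorem spanClass_comm (v w : Fin 2 → ℂ_[p]) : spanClass v w = spanClass w v := by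
  rw [spanClass, spanClass, Set.pair_comm]

theorem spanClass_sub_right (v w : Fin 2 → ℂ_[p]) : spanClass v (w - v) = spanClass v w := by
  rw [spanClass, spanClass]
  congr 1
  apply le_antisymm <;> rw [Submodule.span_le, Set.insert_subset_iff, Set.singleton_subset_iff] <;>
    refine ⟨left_mem_span_pair _ _, ?_⟩
  · exact Submodule.sub_mem _ (right_mem_span_pair _ _) (left_mem_span_pair _ _)
  · have h := Submodule.add_mem _ (right_mem_span_pair v (w - v)) (left_mem_span_pair v (w - v))
    rwa [sub_add_cancel] at h

/-- The path joining two different `k`-rational points contains a vertex whose lattice is generated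
by representatives of the two points: the ball `B(x, |x - y|)` for the points `x, y ∈ k`, and the
ball `B(x, 1)` for `x` and `∞`. -/
theorem exists_mem_endPath_latticeClass_eq {P Q : P1 ℂ_[p]} (hP : P ∈ rationalPoints k)
    (hQ : Q ∈ rationalPoints k) (hPQ : P ≠ Q) :
    ∃ B ∈ endPath k P Q, ∃ (v w : Fin 2 → ℂ_[p]) (hv : v ≠ 0) (hw : w ≠ 0),
      P = Projectivization.mk _ v hv ∧ Q = Projectivization.mk _ w hw ∧
      B.latticeClass = spanClass v w := by
  have hball : ∀ x c : k, c ≠ 0 → ∃ B : BallVertex k, B.1 = Metric.closedBall x ‖c‖ ∧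
      ‖c‖ ∈ absValues k ∧ B.latticeClass = spanClass ![(x : ℂ_[p]), 1] ![(c : ℂ_[p]), 0] :=
    fun x c hc => ⟨⟨Metric.closedBall x ‖c‖, x, _, ⟨c, hc, rfl⟩, rfl⟩, rfl, ⟨c, hc, rfl⟩,
      latticeClass_eq hc rfl⟩
  rcases eq_affinePoint_or_eq_infinityPoint P with ⟨x, rfl⟩ | rfl <;>
    rcases eq_affinePoint_or_eq_infinityPoint Q with ⟨y, rfl⟩ | rfl
  · lift x to k using affinePoint_mem_rationalPoints.1 hP
    lift y to k using affinePoint_mem_rationalPoints.1 hQ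
    have hne : y - x ≠ 0 := by
      rw [sub_ne_zero]
      rintro rfl
      exact hPQ rfl
    obtain ⟨B, hB, hr, hclass⟩ := hball x (y - x) hne
    refine ⟨B, ⟨x, _, hr, hB, Or.inl
      ⟨x, y, rfl, rfl, (norm_sub_rev y x).le, Or.inl ?_⟩⟩, _, _, _, _, rfl, rfl, ?_⟩
    · simp
    · rw [hclass, ← spanClass_sub_right _ ![(y : ℂ_[p]), 1]]
      congr 1
      ext i
      fin_cases i <;> simp
  · lift x to k using affinePoint_mem_rationalPoints.1 hP
    obtain ⟨B, hB, hr, hclass⟩ := hball x 1 one_ne_zero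
    exact ⟨B, ⟨x, _, hr, hB, Or.inr (Or.inl ⟨x, rfl, rfl, by simp⟩)⟩, _, _, _, _, rfl, rfl, hclass⟩
  · lift y to k using affinePoint_mem_rationalPoints.1 hQ
    obtain ⟨B, hB, hr, hclass⟩ := hball y 1 one_ne_zero
    refine ⟨B, ⟨y, _, hr, hB, Or.inr (Or.inr ⟨y, rfl, rfl, by simp⟩)⟩, _, _, _, _, rfl, rfl, ?_⟩
    rw [spanClass_comm]
    exact hclass
  · exact absurd rfl hPQ

/-- The fixed points of an elliptic element are `k`-rational: this holds for the representative of
its conjugacy class, and `G` permutes the `k`-rational points. -/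
theorem IsTreeField.mem_rationalPoints {G : Subgroup PGL(2, ℂ_[p])} (hk : IsTreeField G k)
    {g : PGL(2, ℂ_[p])} (hg : g ∈ G) (hell : IsElliptic g) {P : P1 ℂ_[p]} (hP : g • P = P) :
    P ∈ rationalPoints k := by
  obtain ⟨gens, reps, hgens, -, hreps, hk⟩ := hk
  have hcoeff : ∀ A ∈ gens, ∀ i j, A.1 i j ∈ k := fun A hA i j => by
    rw [hk]
    exact IntermediateField.subset_adjoin _ _ (Set.mem_union_left _ ⟨A, hA, i, j, rfl⟩)
  have hfixed : ∀ r ∈ reps, ∀ z, r • affinePoint z = affinePoint z → z ∈ k := fun r hr z hz => by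
    rw [hk]
    exact IntermediateField.subset_adjoin _ _ (Set.mem_union_right _ ⟨r, hr, hz⟩)
  obtain ⟨r, ⟨hr, h, hh, rfl⟩, -⟩ := hreps g hg hell
  rw [← hgens] at hh
  have hiff : h • P ∈ rationalPoints k ↔ P ∈ rationalPoints k :=
    smul_mem_rationalPoints (fun A hA => hcoeff A (Finset.mem_coe.1 hA)) hh
  rw [← hiff]
  have hfix : (h * g * h⁻¹) • h • P = h • P := by
    rw [mul_smul, mul_smul, inv_smul_smul, hP]
  rcases eq_affinePoint_or_eq_infinityPoint (h • P) with ⟨z, hz⟩ | hz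
  · rw [hz] at hfix ⊢
    exact affinePoint_mem_rationalPoints.2 (hfixed _ hr z hfix)
  · rw [hz]
    exact infinityPoint_mem_rationalPoints k

theorem mulVec_eq_smul_of_mk_eq {K : Type*} [Field K] {A : Matrix (Fin 2) (Fin 2) K} {a : K}
    {v w : Fin 2 → K} {hv : v ≠ 0} {hw : w ≠ 0}
    (h : Projectivization.mk K v hv = Projectivization.mk K w hw) (hA : A *ᵥ v = a • v) :
    A *ᵥ w = a • w := by
  obtain ⟨t, rfl⟩ := (Projectivization.mk_eq_mk_iff' K _ _ _ _).1 h.symm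
  rw [mulVec_smul, hA, smul_comm]

/-- A non-trivial element of finite order is elliptic, and it fixes a vertex on the path joining its
two fixed points, which are `k`-rational. -/
theorem IsTreeField.exists_smul_latticeClass_eq {G : Subgroup PGL(2, ℂ_[p])}
    (hk : IsTreeField G k) {g : PGL(2, ℂ_[p])} (hg : g ∈ G) (hg1 : g ≠ 1) (hfin : IsOfFinOrder g) :
    ∃ B : (starTree G k).verts, g • B.1.latticeClass = B.1.latticeClass := by
  obtain ⟨A, rfl⟩ := ProjGenLinGroup.mk_surjective g
  obtain ⟨m, hm, hpow⟩ := isOfFinOrder_iff_pow_eq_one.1 hfin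
  rw [← map_pow, ProjGenLinGroup.mk_eq_one, GeneralLinearGroup.center_eq_range_scalar] at hpow
  obtain ⟨c, hc⟩ := hpow
  obtain ⟨a, b, v, w, hab, hnorm, ha, hv, hw, hva, hwb, hchar⟩ :=
    exists_eigenvectors_of_pow_eq_scalar hm hc.symm hg1
  have hell : IsElliptic (ProjGenLinGroup.mk A) := ⟨A, a, b, rfl, hab, hnorm, hchar⟩
  have hfix : ∀ (z : ℂ_[p]) (u : Fin 2 → ℂ_[p]) (hu : u ≠ 0), A.1 *ᵥ u = z • u →
      ProjGenLinGroup.mk A • Projectivization.mk ℂ_[p] u hu = Projectivization.mk ℂ_[p] u hu :=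
    fun z u hu hz => (Projectivization.mk_eq_mk_iff' _ _ _ _ _).2 ⟨z, hz.symm⟩
  have hne : Projectivization.mk ℂ_[p] v hv ≠ Projectivization.mk ℂ_[p] w hw := fun h =>
    hab (smul_left_injective ℂ_[p] hw ((mulVec_eq_smul_of_mk_eq h hva).symm.trans hwb))
  obtain ⟨B, hB, v', w', hv', hw', hvv', hww', hclass⟩ := exists_mem_endPath_latticeClass_eq
    (hk.mem_rationalPoints hg hell (hfix a v hv hva))
    (hk.mem_rationalPoints hg hell (hfix b w hw hwb)) hne
  refine ⟨⟨B, _, ⟨_, hg, hg1, hfix a v hv hva⟩, _, ⟨_, hg, hg1, hfix b w hw hwb⟩, hne, hB⟩, ?_⟩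
  dsimp only
  rw [hclass]
  exact mk_smul_span_eigenvectors ha hnorm (mulVec_eq_smul_of_mk_eq hvv' hva)
    (mulVec_eq_smul_of_mk_eq hww' hwb)

end DiscontinuousGroups

open DiscontinuousGroups in
theorem mainTheorem4 (p : ℕ) [Fact p.Prime] (G : Subgroup PGL(2, ℂ_[p])) (hfg : G.FG)
    (hG : IsDiscontinuous G) (k : IntermediateField ℚ_[p] ℂ_[p]) (hk : IsTreeField G k)
    {H : Type*} [Group H] [Finite H] (φ : G →* H) :
    IsSchottky (φ.ker.map G.subtype) ↔
      ∀ v : QuotientVertex G k, ∀ S ∈ vertexGroups v, Set.InjOn φ S := by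
  constructor
  · rintro ⟨-, -, htors⟩ _ _ ⟨B, -, rfl⟩ x hx y hy hxy
    have hker : x * y⁻¹ ∈ φ.ker := by
      rw [MonoidHom.mem_ker, map_mul, map_inv, hxy, mul_inv_cancel]
    have hstab := mul_mem hx (inv_mem hy)
    have h := htors _ (Subgroup.mem_map_of_mem G.subtype hker)
      (hG.isOfFinOrder_of_mem_stabilizer hstab)
    exact mul_inv_eq_one.1 (G.subtype_injective h)
  · intro hinj
    refine ⟨hG.mono (Subgroup.map_subtype_le _), fg_map_ker hfg φ, ?_⟩
    rintro _ ⟨g, hg, rfl⟩ hfin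
    by_contra hg1
    obtain ⟨B, hB⟩ := hk.exists_smul_latticeClass_eq g.2 hg1 hfin
    have h := hinj (Quotient.mk _ B) _ ⟨B, rfl, rfl⟩ (show g ∈ MulAction.stabilizer G _ from hB)
      (one_mem (MulAction.stabilizer G _)) ((MonoidHom.mem_ker.1 hg).trans (map_one φ).symm)
    exact hg1 (congrArg G.subtype h)
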